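/- Let $M$ be a smooth $3$-manifold (Hausdorff, second countable, without boundary; all objects on $M$ are smooth), let $\alpha\in\Omega^1(M)$ be a contact form, i.e. $\alpha\wedge d\alpha$ is nowhere zero, and let $M$ carry the orientation given by $\alpha\wedge d\alpha$. For a Riemannian metric $g$ on $M$ let $\ast_g$ be its Hodge star operator and $\sharp$ its isomorphism $T^*M\to TM$; $g$ is called adapted to $\alpha$ if $d\alpha=2\ast_g\alpha$ and $g(\alpha^\sharp,\alpha^\sharp)=1$. Let $\omega\in\mathbb R\setminus\{0\}$. Then there are a Riemannian metric $g_0$ on $M$ adapted to $\alpha$ and a $1$-form $\beta\in\Omega^1(M)$ such that, in the electromagnetic medium $g_\varepsilon=g_\mu=g:=\tfrac{4}{\omega^2}\,g_0$, the fields $$E(x,t)=\operatorname{Re}\{\alpha e^{i\omega t}\},\qquad H(x,t)=\operatorname{Im}\{\beta e^{i\omega t}\},\qquad (x,t)\in M\times\mathbb R,$$ together with $D=\ast_g E$ and $B=\ast_g H$ (the constitutive equations $D=\ast_\varepsilon E$, $B=\ast_\mu H$ of this medium), solve the source-free Maxwell equations $$dE=-\frac{\partial B}{\partial t},\qquad dH=\frac{\partial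 D}{\partial t},\qquad dD=0,\qquad dB=0 .$$ -/

import Mathlib

open scoped Manifold ContDiff Bundle

noncomputable section

namespace ContactMaxwell

/-- The model space `ℝ³`. -/
abbrev E3 : Type := EuclideanSpace ℝ (Fin 3)

section Algebra

/-- The covector underlying an alternating `1`-form. -/
def toCovector {V : Type*} [AddCommGroup V] [Module ℝ V] [TopologicalSpace V]
    (a : V [⋀^Fin 1]→L[ℝ] ℝ) : V →L[ℝ] ℝ :=
  (ContinuousAlternatingMap.ofSubsingleton ℝ V ℝ (0 : Fin 1)).symm a

theorem toCovector_apply {V : Type*} [AddCommGroup V] [Module ℝ V] [TopologicalSpace V]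
    (a : V [⋀^Fin 1]→L[ℝ] ℝ) (v : V) : toCovector a v = a ![v] := by
  change a _ = a _
  congr 1
  ext i
  fin_cases i
  rfl

/-- The wedge product of an alternating `1`-form and an alternating `k`-form:
`(a ∧ η)(v₀, …, v_k) = ∑ i, (-1) ^ i a(v_i) η(v₀, …, v_{i-1}, v_{i+1}, …, v_k)`. -/
def wedgeAlt {k : ℕ} (a : E3 [⋀^Fin 1]→L[ℝ] ℝ) (η : E3 [⋀^Fin k]→L[ℝ] ℝ) :
    E3 [⋀^Fin (k + 1)]→L[ℝ] ℝ :=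
  ContinuousAlternatingMap.alternatizeUncurryFin ((toCovector a).smulRight η)

/-- The interior product `ι_v η`, that is `(ι_v η)(v₁, …, v_k) = η(v, v₁, …, v_k)`. -/
def interiorAlt {k : ℕ} (v : E3) (η : E3 [⋀^Fin (k + 1)]→L[ℝ] ℝ) : E3 [⋀^Fin k]→L[ℝ] ℝ :=
  η.curryLeft v

end Algebra

variable {M : Type*} [TopologicalSpace M] [ChartedSpace E3 M]

variable (M) in
/-- Fields of alternating `k`-forms on the tangent spaces of a `3`-manifold `M`. Smoothness is the
separate predicate `IsSmoothForm`. -/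
abbrev Form (k : ℕ) : Type _ := ∀ x : M, TangentSpace (𝓡 3) x [⋀^Fin k]→L[ℝ] ℝ

/-- The expression of a `k`-form in the chart around `x₀`: its pullback under the inverse of the
chart (meaningful on the target of the chart). -/
def chartRep {k : ℕ} (η : Form M k) (x₀ : M) (y : E3) : E3 [⋀^Fin k]→L[ℝ] ℝ :=
  (η ((extChartAt (𝓡 3) x₀).symm y)).compContinuousLinearMap
    (mfderiv 𝓘(ℝ, E3) (𝓡 3) (extChartAt (𝓡 3) x₀).symm y)

/-- A `k`-form is smooth if it is smooth in the charts. -/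
def IsSmoothForm {k : ℕ} (η : Form M k) : Prop :=
  ∀ x₀ : M, ContDiffOn ℝ ∞ (chartRep η x₀) (extChartAt (𝓡 3) x₀).target

/-- A `k`-form depending on a parameter `t ∈ ℝ` is smooth if, in the charts, it is smooth jointly
in `t` and in the point. -/
def IsSmoothFamily {k : ℕ} (η : ℝ → Form M k) : Prop :=
  ∀ x₀ : M, ContDiffOn ℝ ∞ (fun p : ℝ × E3 ↦ chartRep (η p.1) x₀ p.2)
    (Set.univ ×ˢ (extChartAt (𝓡 3) x₀).target)

/-- The exterior derivative: at `x`, the pullback by the chart around `x` of the exterior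
derivative of the expression of the form in that chart. -/
def extDer {k : ℕ} (η : Form M k) : Form M (k + 1) := fun x ↦
  (extDeriv (chartRep η x) (extChartAt (𝓡 3) x x)).compContinuousLinearMap
    (mfderiv (𝓡 3) 𝓘(ℝ, E3) (extChartAt (𝓡 3) x) x)

/-- The wedge product of a `1`-form and a `k`-form. -/
def wedge {k : ℕ} (a : Form M 1) (η : Form M k) : Form M (k + 1) := fun x ↦ wedgeAlt (a x) (η x)

/-- A contact form: a smooth `1`-form `α` such that `α ∧ dα` vanishes nowhere. -/
structure IsContactForm (α : Form M 1) : Prop where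
  smooth : IsSmoothForm α
  wedge_ne_zero : ∀ x, wedge α (extDer α) x ≠ 0

/-- The source-free Maxwell equations for time dependent fields. Time derivatives of forms are taken
at each point, on each tuple of tangent vectors. -/
structure IsSourceFreeMaxwell (E H : ℝ → Form M 1) (D B : ℝ → Form M 2) : Prop where
  smooth_E : IsSmoothFamily E
  smooth_H : IsSmoothFamily H
  smooth_D : IsSmoothFamily D
  smooth_B : IsSmoothFamily B
  /-- `dE = - ∂B/∂t` -/
  faraday : ∀ t x v, HasDerivAt (fun s ↦ B s x v) (-(extDer (E t) x v)) t
  /-- `dH = ∂D/∂t` -/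
  ampere : ∀ t x v, HasDerivAt (fun s ↦ D s x v) (extDer (H t) x v) t
  /-- `dD = 0` -/
  gauss_D : ∀ t x, extDer (D t) x = 0
  /-- `dB = 0` -/
  gauss_B : ∀ t x, extDer (B t) x = 0

variable (M) in
/-- Smooth Riemannian metrics on `M`. -/
abbrev RMetric [IsManifold (𝓡 3) ∞ M] : Type _ :=
  Bundle.ContMDiffRiemannianMetric (𝓡 3) ∞ E3 (fun x : M ↦ TangentSpace (𝓡 3) x)

/-- The coordinate basis of the tangent space at `x` given by the chart around `x`. -/
def coordVec (x : M) (i : Fin 3) : TangentSpace (𝓡 3) x := EuclideanSpace.single i (1 : ℝ)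

variable [IsManifold (𝓡 3) ∞ M]

/-- The Gram matrix `g_{ij}` of a metric in the coordinate basis at `x`. -/
def gram (g : RMetric M) (x : M) : Matrix (Fin 3) (Fin 3) ℝ :=
  Matrix.of fun i j ↦ g.inner x (coordVec x i) (coordVec x j)

/-- The Riemannian volume form of `g` for the orientation given by a nowhere vanishing `3`-form
`θ`. In the coordinate basis `∂₁, ∂₂, ∂₃` it is `± √|g| dx¹ ∧ dx² ∧ dx³` where the sign is that
of `θ(∂₁, ∂₂, ∂₃)`, that is, `√|g| dx¹ ∧ dx² ∧ dx³` in positively oriented coordinates. -/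
def volForm (g : RMetric M) (θ : Form M 3) : Form M 3 := fun x ↦
  (Real.sqrt (gram g x).det / |θ x (coordVec x)|) • θ x

/-- The vector `a♯` dual to a `1`-form `a` with respect to `g`: `g(a♯, w) = a(w)`. -/
def sharp (g : RMetric M) (a : Form M 1) (x : M) : TangentSpace (𝓡 3) x :=
  (g.inner x).inverse (toCovector (a x))

/-- The Hodge star operator on `1`-forms, of the metric `g` and the orientation given by the
`3`-form `θ`: `⋆ a = ι_{a♯} dV`. In positively oriented coordinates this says
`⋆ dxⁱ = (√|g| / 2) g^{il} ε_{lmn} dx^m ∧ dx^n`. -/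
def hodge (g : RMetric M) (θ : Form M 3) (a : Form M 1) : Form M 2 := fun x ↦
  interiorAlt (sharp g a x) (volForm g θ x)

/-- A Riemannian metric `g` is adapted to a contact form `α` if `dα = 2 ⋆ α` and
`g(α♯, α♯) = 1`, where `M` carries the orientation given by `α ∧ dα`. -/
structure IsAdapted (g : RMetric M) (α : Form M 1) : Prop where
  extDer_eq : ∀ x, extDer α x = (2 : ℝ) • hodge g (wedge α (extDer α)) α x
  norm_sharp : ∀ x, g.inner x (sharp g α x) (sharp g α x) = 1

/-- The constitutive equations `D = ⋆_ε E` and `B = ⋆_μ H` of the electromagnetic medium given by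
the Riemannian metrics `gε` and `gμ`, where `M` is oriented by the `3`-form `θ`. -/
structure IsConstitutive (gε gμ : RMetric M) (θ : Form M 3)
    (E H : ℝ → Form M 1) (D B : ℝ → Form M 2) : Prop where
  electric : ∀ t x, D t x = hodge gε θ (E t) x
  magnetic : ∀ t x, B t x = hodge gμ θ (H t) x

end ContactMaxwell

end

/-!
At each point let `R` be the Reeb vector: `α(R) = 1` and `ι_R dα = 0`. Then `ι_R (α ∧ dα) = dα`,
so a metric for which `R♭ = α` and whose volume form is `½ α ∧ dα` satisfies `2 ⋆ α = dα` and
`|α♯| = |R| = 1`, that is, it is adapted to `α`. The condition `R♭ = α` is convex in the metric,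
hence local solutions can be glued by a partition of unity, and the volume form is then corrected by
rescaling the metric on `ker α`, which does not affect `R♭ = α`.

On `1`-forms in dimension `3`, multiplying the metric by `k` multiplies `⋆` by `√k`. For
`k = 4 / ω²` the equation `dα = 2 ⋆ α` becomes `⋆ α = c dα` with `(ω c)² = 1`: `α` is a Beltrami
field, and Maxwell's equations reduce to ordinary differential equations for the amplitudes
`cos (ω t)` and `sin (ω t)`.
-/

noncomputable section

namespace ContactMaxwell

section AlternatingAlgebra

theorem alternatingMap_comp_eq_det_mul {R V ι : Type*} [CommRing R] [AddCommGroup V] [Module R V]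
    [Finite ι] (e : Module.Basis ι R V) (f : V [⋀^ι]→ₗ[R] R) (L : V →ₗ[R] V) (v : ι → V) :
    f (L ∘ v) = LinearMap.det L * f v := by
  classical
  have := Fintype.ofFinite ι
  rw [f.eq_smul_basis_det e]
  simp only [AlternatingMap.smul_apply, e.det_comp, smul_eq_mul]
  ring

theorem alternatingMap_update_basis {R V ι : Type*} [CommRing R] [AddCommGroup V]
    [Module R V] [Finite ι] [DecidableEq ι] (e : Module.Basis ι R V) (f : V [⋀^ι]→ₗ[R] R) (i : ι)
    (v : V) : f (Function.update e i v) = e.repr v i * f e := by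
  suffices f.toMultilinearMap.toLinearMap e i = f e • e.coord i by
    simpa [mul_comm] using LinearMap.congr_fun this v
  refine e.ext fun j ↦ ?_
  rcases eq_or_ne j i with rfl | hji
  · simp
  · simpa [Finsupp.single_eq_of_ne' hji] using f.map_update_self _ hji.symm

theorem eq_zero_of_curryLeft_eq_zero {K V : Type*} [Field K] [AddCommGroup V] [Module K V] {n : ℕ}
    (hV : Module.finrank K V = n + 1) {θ : V [⋀^Fin (n + 1)]→ₗ[K] K} (hθ : θ ≠ 0) {v : V}
    (hv : θ.curryLeft v = 0) : v = 0 := by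
  have := Module.finite_of_finrank_eq_succ hV
  let e : Module.Basis (Fin (n + 1)) K V := Module.finBasisOfFinrankEq K V hV
  refine e.repr.map_eq_zero_iff.1 (Finsupp.ext fun i ↦ ?_)
  have h : θ (Function.update e i v) = 0 := by
    rw [← Fin.insertNth_removeNth, θ.map_insertNth, ← θ.curryLeft_apply_apply, hv]
    simp
  rw [alternatingMap_update_basis] at h
  exact (mul_eq_zero.1 h).resolve_right ((AlternatingMap.map_basis_ne_zero_iff e θ).2 hθ)

theorem exists_ne_zero_of_isAlt_of_odd_finrank {K V : Type*} [Field K] [NeZero (2 : K)]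
    [AddCommGroup V] [Module K V] (hV : Odd (Module.finrank K V)) {B : LinearMap.BilinForm K V}
    (hB : B.IsAlt) : ∃ v ≠ 0, B v = 0 := by
  have := Module.finite_of_finrank_pos hV.pos
  let A := LinearMap.BilinForm.toMatrix (Module.finBasis K V) B
  have hA : A.transpose = -A := by
    ext i j
    simp [A, LinearMap.BilinForm.toMatrix_apply, hB.neg_eq]
  have hdet : A.det = -A.det := by
    conv_lhs => rw [← A.det_transpose, hA, A.det_neg, Fintype.card_fin, hV.neg_one_pow, neg_one_mul]
  have hdet0 : A.det = 0 :=
    (mul_eq_zero.1 (by linear_combination hdet : (2 : K) * A.det = 0)).resolve_left two_ne_zero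
  rw [← not_ne_iff, ← LinearMap.BilinForm.nondegenerate_iff_det_ne_zero,
    LinearMap.BilinForm.nondegenerate_iff_ker_eq_bot, ← ne_eq, Submodule.ne_bot_iff] at hdet0
  obtain ⟨v, hv, hv0⟩ := hdet0
  exact ⟨v, hv0, hv⟩

theorem toCovector_compContinuousLinearMap {V W : Type*} [AddCommGroup V] [Module ℝ V]
    [TopologicalSpace V] [AddCommGroup W] [Module ℝ W] [TopologicalSpace W]
    (a : W [⋀^Fin 1]→L[ℝ] ℝ) (L : V →L[ℝ] W) :
    toCovector (a.compContinuousLinearMap L) = toCovector a ∘L L :=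
  rfl

theorem wedgeAlt_apply {k : ℕ} (a : E3 [⋀^Fin 1]→L[ℝ] ℝ) (η : E3 [⋀^Fin k]→L[ℝ] ℝ)
    (v : Fin (k + 1) → E3) :
    wedgeAlt a η v =
      ∑ i : Fin (k + 1), (-1) ^ (i : ℕ) * (toCovector a (v i) * η (i.removeNth v)) := by
  simp [wedgeAlt, ContinuousAlternatingMap.alternatizeUncurryFin_apply]

theorem wedgeAlt_compContinuousLinearMap {k : ℕ} (a : E3 [⋀^Fin 1]→L[ℝ] ℝ)
    (η : E3 [⋀^Fin k]→L[ℝ] ℝ) (L : E3 →L[ℝ] E3) :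
    wedgeAlt (a.compContinuousLinearMap L) (η.compContinuousLinearMap L) =
      (wedgeAlt a η).compContinuousLinearMap L := by
  ext v
  simp only [wedgeAlt_apply, toCovector_compContinuousLinearMap,
    ContinuousAlternatingMap.compContinuousLinearMap_apply]
  rfl

theorem interiorAlt_wedgeAlt {k : ℕ} (v : E3) (a : E3 [⋀^Fin 1]→L[ℝ] ℝ)
    (η : E3 [⋀^Fin (k + 1)]→L[ℝ] ℝ) :
    interiorAlt v (wedgeAlt a η) = toCovector a v • η - wedgeAlt a (interiorAlt v η) := by
  ext w
  have hremove (i : Fin (k + 1)) :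
      (i.succ.removeNth (Matrix.vecCons v w) : Fin (k + 1) → E3) =
        Matrix.vecCons v (i.removeNth w) := by
    ext j : 1
    cases j using Fin.cases <;> simp [Fin.removeNth]
  change wedgeAlt a η (Matrix.vecCons v w) =
    toCovector a v * η w - wedgeAlt a (interiorAlt v η) w
  rw [wedgeAlt_apply, wedgeAlt_apply, Fin.sum_univ_succ, sub_eq_add_neg, ← Finset.sum_neg_distrib]
  simp only [hremove, Fin.val_zero, pow_zero, one_mul, Matrix.cons_val_zero, Matrix.cons_val_succ,
    Fin.val_succ, pow_succ, mul_neg_one, neg_mul, interiorAlt,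
    ContinuousAlternatingMap.curryLeft_apply_apply]
  rfl

theorem interiorAlt_smul {k : ℕ} (c : ℝ) (v : E3) (η : E3 [⋀^Fin (k + 1)]→L[ℝ] ℝ) :
    interiorAlt (c • v) η = c • interiorAlt v η :=
  map_smul η.curryLeft c v

theorem wedgeAlt_zero {k : ℕ} (a : E3 [⋀^Fin 1]→L[ℝ] ℝ) :
    wedgeAlt a (0 : E3 [⋀^Fin k]→L[ℝ] ℝ) = 0 := by
  ext v
  simp [wedgeAlt_apply]

section ToBilin

variable {V W : Type*} [NormedAddCommGroup V] [NormedSpace ℝ V] [NormedAddCommGroup W]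
  [NormedSpace ℝ W]

/-- The bilinear form of an alternating `2`-form, as a curried continuous bilinear map. -/
def toBilin (η : V [⋀^Fin 2]→L[ℝ] ℝ) : V →L[ℝ] V →L[ℝ] ℝ :=
  (ContinuousAlternatingMap.ofSubsingletonLIE (𝕜 := ℝ) (E := V) (F := ℝ)
    (0 : Fin 1)).symm.toContinuousLinearEquiv ∘L η.curryLeft

theorem toBilin_apply (η : V [⋀^Fin 2]→L[ℝ] ℝ) (v w : V) : toBilin η v w = η ![v, w] :=
  toCovector_apply (η.curryLeft v) w

theorem toBilin_self (η : V [⋀^Fin 2]→L[ℝ] ℝ) (v : V) : toBilin η v v = 0 := by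
  rw [toBilin_apply]
  exact η.map_eq_zero_of_eq _ (i := 0) (j := 1) rfl zero_ne_one

theorem toBilin_swap (η : V [⋀^Fin 2]→L[ℝ] ℝ) (v w : V) : toBilin η v w = -toBilin η w v := by
  have h := toBilin_self η (v + w)
  simp only [map_add, add_apply, toBilin_self] at h
  linarith

theorem toBilin_compContinuousLinearMap (η : W [⋀^Fin 2]→L[ℝ] ℝ) (L : V →L[ℝ] W) :
    toBilin (η.compContinuousLinearMap L) = (toBilin η).bilinearComp L L := by
  ext v w
  rw [ContinuousLinearMap.bilinearComp_apply, toBilin_apply, toBilin_apply,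
    ContinuousAlternatingMap.compContinuousLinearMap_apply]
  congr 1
  ext i : 1
  fin_cases i <;> rfl

theorem interiorAlt_eq_zero_iff {η : E3 [⋀^Fin 2]→L[ℝ] ℝ} {v : E3} :
    interiorAlt v η = 0 ↔ toBilin η v = 0 :=
  ((ContinuousAlternatingMap.ofSubsingletonLIE (𝕜 := ℝ) (E := E3) (F := ℝ)
    (0 : Fin 1)).symm.map_eq_zero_iff (x := η.curryLeft v)).symm

end ToBilin

end AlternatingAlgebra

section InnerProducts

variable {V W : Type*} [NormedAddCommGroup V] [NormedSpace ℝ V] [NormedAddCommGroup W]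
  [NormedSpace ℝ W]

/-- A continuous bilinear form is an inner product if it is symmetric and positive definite. -/
structure IsInnerProduct (b : V →L[ℝ] V →L[ℝ] ℝ) : Prop where
  symm : ∀ v w, b v w = b w v
  pos : ∀ v, v ≠ 0 → 0 < b v v

theorem convex_setOf_isInnerProduct : Convex ℝ {b : V →L[ℝ] V →L[ℝ] ℝ | IsInnerProduct b} := by
  intro b hb c hc s t hs ht hst
  refine ⟨fun v w ↦ ?_, fun v hv ↦ ?_⟩
  · simp [hb.symm v w, hc.symm v w]
  · exact convex_Ioi (0 : ℝ) (hb.pos v hv) (hc.pos v hv) hs ht hst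

namespace IsInnerProduct

variable {b : V →L[ℝ] V →L[ℝ] ℝ}

theorem bilinearComp {b : W →L[ℝ] W →L[ℝ] ℝ} (hb : IsInnerProduct b) {L : V →L[ℝ] W}
    (hL : Function.Injective L) : IsInnerProduct (b.bilinearComp L L) where
  symm v w := hb.symm (L v) (L w)
  pos v hv := hb.pos (L v) ((map_ne_zero_iff L hL).2 hv)

theorem injective (hb : IsInnerProduct b) : Function.Injective b := by
  refine (injective_iff_map_eq_zero b).2 fun v hv ↦ by_contra fun hv0 ↦ (hb.pos v hv0).ne' ?_
  rw [hv, zero_apply]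

theorem isInvertible [FiniteDimensional ℝ V] (hb : IsInnerProduct b) : b.IsInvertible := by
  have hdim : Module.finrank ℝ V = Module.finrank ℝ (V →L[ℝ] ℝ) := by
    rw [← (LinearMap.toContinuousLinearMap : (V →ₗ[ℝ] ℝ) ≃ₗ[ℝ] V →L[ℝ] ℝ).finrank_eq]
    exact Subspace.dual_finrank_eq.symm
  exact ⟨(LinearMap.linearEquivOfInjective (b : V →ₗ[ℝ] V →L[ℝ] ℝ) hb.injective
    hdim).toContinuousLinearEquiv, by ext; rfl⟩

theorem exists_pos_mul_sq_norm_le [FiniteDimensional ℝ V] (hb : IsInnerProduct b) :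
    ∃ m > 0, ∀ v, m * ‖v‖ ^ 2 ≤ b v v := by
  rcases subsingleton_or_nontrivial V with _ | _
  · exact ⟨1, one_pos, fun v ↦ by simp [Subsingleton.elim v 0]⟩
  obtain ⟨u, hu, hmin⟩ := (isCompact_sphere (0 : V) 1).exists_isMinOn
    (NormedSpace.sphere_nonempty.2 zero_le_one)
    (show Continuous fun v ↦ b v v by fun_prop).continuousOn
  refine ⟨b u u, hb.pos u (ne_zero_of_mem_unit_sphere ⟨u, hu⟩), fun v ↦ ?_⟩
  rcases eq_or_ne v 0 with rfl | hv
  · simp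
  have hn : ‖v‖ ≠ 0 := norm_ne_zero_iff.2 hv
  calc b u u * ‖v‖ ^ 2 ≤ b (‖v‖⁻¹ • v) (‖v‖⁻¹ • v) * ‖v‖ ^ 2 := by
        gcongr
        exact hmin (by simp [norm_smul, hn])
    _ = b v v := by
        simp only [map_smul, smul_apply, smul_eq_mul]
        field_simp

theorem isVonNBounded [FiniteDimensional ℝ V] (hb : IsInnerProduct b) :
    Bornology.IsVonNBounded ℝ {v | b v v < 1} := by
  obtain ⟨m, hm, hle⟩ := hb.exists_pos_mul_sq_norm_le
  rw [NormedSpace.isVonNBounded_iff, isBounded_iff_forall_norm_le]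
  refine ⟨√(1 / m), fun v hv ↦ Real.le_sqrt_of_sq_le ?_⟩
  rw [le_div_iff₀' hm]
  exact (hle v).trans (le_of_lt hv)

end IsInnerProduct

variable {ι : Type*}

theorem apply_basis_ne_zero [Finite ι] (e : Module.Basis ι ℝ V) {θ : V [⋀^ι]→L[ℝ] ℝ} (hθ : θ ≠ 0) :
    θ e ≠ 0 :=
  (AlternatingMap.map_basis_ne_zero_iff e θ.toAlternatingMap).2
    (ContinuousAlternatingMap.toAlternatingMap_injective.ne hθ)

variable [Fintype ι] [DecidableEq ι]

/-- The Gram matrix of a bilinear form in a basis. -/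
abbrev gramMatrix (e : Module.Basis ι ℝ V) (b : V →L[ℝ] V →L[ℝ] ℝ) : Matrix ι ι ℝ :=
  LinearMap.BilinForm.toMatrix e b.toBilinForm

theorem IsInnerProduct.det_gramMatrix_pos {b : V →L[ℝ] V →L[ℝ] ℝ} (hb : IsInnerProduct b)
    (e : Module.Basis ι ℝ V) : 0 < (gramMatrix e b).det :=
  ((LinearMap.BilinForm.posDef_toQuadraticMap_iff_matrix e b.toBilinForm ⟨hb.symm⟩).1
    hb.pos).det_pos

theorem det_gramMatrix_bilinearComp (e : Module.Basis ι ℝ V) (b : V →L[ℝ] V →L[ℝ] ℝ)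
    (L : V →L[ℝ] V) :
    (gramMatrix e (b.bilinearComp L L)).det =
      LinearMap.det (L : V →ₗ[ℝ] V) ^ 2 * (gramMatrix e b).det := by
  have h := LinearMap.BilinForm.toMatrix_comp e e b.toBilinForm (L : V →ₗ[ℝ] V) (L : V →ₗ[ℝ] V)
  change (LinearMap.BilinForm.toMatrix e (b.toBilinForm.comp L L)).det = _
  rw [h, Matrix.det_mul, Matrix.det_mul, Matrix.det_transpose, LinearMap.det_toMatrix]
  ring

/-- The ratio of the volume form `θ` and the volume form of the inner product `b`, up to sign; it
does not depend on the basis `e`. -/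
def volRatio (e : Module.Basis ι ℝ V) (θ : V [⋀^ι]→L[ℝ] ℝ) (b : V →L[ℝ] V →L[ℝ] ℝ) : ℝ :=
  |θ e| / √(gramMatrix e b).det

theorem volRatio_pos (e : Module.Basis ι ℝ V) {θ : V [⋀^ι]→L[ℝ] ℝ} (hθ : θ ≠ 0)
    {b : V →L[ℝ] V →L[ℝ] ℝ} (hb : IsInnerProduct b) : 0 < volRatio e θ b :=
  div_pos (abs_pos.2 (apply_basis_ne_zero e hθ)) (Real.sqrt_pos.2 (hb.det_gramMatrix_pos e))

theorem volRatio_bilinearComp (e : Module.Basis ι ℝ V) (θ : V [⋀^ι]→L[ℝ] ℝ)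
    (b : V →L[ℝ] V →L[ℝ] ℝ) (L : V →L[ℝ] V) :
    volRatio e θ (b.bilinearComp L L) =
      volRatio e θ b / |LinearMap.det (L : V →ₗ[ℝ] V)| := by
  rw [volRatio, volRatio, det_gramMatrix_bilinearComp, Real.sqrt_mul (sq_nonneg _),
    Real.sqrt_sq_eq_abs, div_div, mul_comm]

theorem volRatio_compContinuousLinearMap (e : Module.Basis ι ℝ V) (θ : V [⋀^ι]→L[ℝ] ℝ)
    (b : V →L[ℝ] V →L[ℝ] ℝ) (L : V →L[ℝ] V) :
    volRatio e (θ.compContinuousLinearMap L) b =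
      |LinearMap.det (L : V →ₗ[ℝ] V)| * volRatio e θ b := by
  have h : θ.compContinuousLinearMap L e = LinearMap.det (L : V →ₗ[ℝ] V) * θ e :=
    alternatingMap_comp_eq_det_mul e θ.toAlternatingMap (L : V →ₗ[ℝ] V) e
  rw [volRatio, volRatio, h, abs_mul, mul_div_assoc]

theorem volRatio_smul (e : Module.Basis ι ℝ V) (θ : V [⋀^ι]→L[ℝ] ℝ) {k : ℝ} (hk : 0 ≤ k)
    (b : V →L[ℝ] V →L[ℝ] ℝ) :
    volRatio e θ (k • b) = volRatio e θ b / √k ^ Fintype.card ι := by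
  have h : gramMatrix e (k • b) = k • gramMatrix e b := map_smul _ k b.toBilinForm
  have hsqrt : √(k ^ Fintype.card ι) = √k ^ Fintype.card ι := by
    rw [Real.sqrt_eq_iff_mul_self_eq (pow_nonneg hk _) (pow_nonneg (Real.sqrt_nonneg k) _),
      ← mul_pow, Real.mul_self_sqrt hk]
  rw [volRatio, volRatio, h, Matrix.det_smul, Real.sqrt_mul (pow_nonneg hk _), hsqrt, mul_comm,
    div_mul_eq_div_div]

end InnerProducts

section ReebMetrics

variable {V W : Type*} [NormedAddCommGroup V] [NormedSpace ℝ V] [NormedAddCommGroup W]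
  [NormedSpace ℝ W]

/-- Rescaling of the bilinear form `b` by the factor `c` on the kernel of the covector `a`. -/
def scaleKer (a : V →L[ℝ] ℝ) (c : ℝ) (b : V →L[ℝ] V →L[ℝ] ℝ) : V →L[ℝ] V →L[ℝ] ℝ :=
  a.smulRight a + c • (b - a.smulRight a)

/-- The linear map which is multiplication by `s` on the kernel of `a` and fixes a vector `r` with
`a r = 1`. -/
def dilateKer (a : V →L[ℝ] ℝ) (r : V) (s : ℝ) : V →L[ℝ] V :=
  s • ContinuousLinearMap.id ℝ V + (1 - s) • a.smulRight r

theorem dilateKer_apply (a : V →L[ℝ] ℝ) (r : V) (s : ℝ) (v : V) :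
    dilateKer a r s v = s • v + ((1 - s) * a v) • r := by
  simp [dilateKer, mul_smul]

section

variable {a : V →L[ℝ] ℝ} {r : V} (har : a r = 1)

include har

theorem mul_det_dilateKer [FiniteDimensional ℝ V] {s : ℝ} (hs : s ≠ 0) :
    s * LinearMap.det (dilateKer a r s : V →ₗ[ℝ] V) = s ^ Module.finrank ℝ V := by
  have h : (dilateKer a r s : V →ₗ[ℝ] V) =
      s • LinearMap.transvection (((1 - s) / s) • (a : V →ₗ[ℝ] ℝ)) r := by
    ext v
    suffices (1 - s) * a v = s * ((1 - s) / s * a v) by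
      simpa [dilateKer_apply, LinearMap.transvection.apply, smul_smul] using congrArg (· • r) this
    field_simp
  have hdet : 1 + (((1 - s) / s) • (a : V →ₗ[ℝ] ℝ)) r = s⁻¹ := by
    simp only [LinearMap.smul_apply, ContinuousLinearMap.coe_coe, har, smul_eq_mul]
    field_simp
    ring
  rw [h, LinearMap.det_smul, LinearMap.transvection.det, hdet]
  field_simp

theorem scaleKer_eq_bilinearComp {b : V →L[ℝ] V →L[ℝ] ℝ} (hb : IsInnerProduct b) (hr : b r = a)
    {c : ℝ} (hc : 0 ≤ c) :
    scaleKer a c b = b.bilinearComp (dilateKer a r √c) (dilateKer a r √c) := by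
  ext v w
  have hsq : √c ^ 2 = c := Real.sq_sqrt hc
  simp only [scaleKer, dilateKer_apply, ContinuousLinearMap.bilinearComp_apply, map_add, map_smul,
    add_apply, sub_apply, smul_apply, ContinuousLinearMap.smulRight_apply, smul_eq_mul, hr, har,
    hb.symm v r]
  linear_combination (a v * a w - b v w) * hsq

theorem injective_dilateKer {s : ℝ} (hs : s ≠ 0) : Function.Injective (dilateKer a r s) := by
  refine (injective_iff_map_eq_zero _).2 fun v hv ↦ ?_
  have hav : a v = 0 := by
    have h : s * a v + (1 - s) * a v = 0 := by simpa [dilateKer_apply, har] using congrArg a hv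
    linear_combination h
  simpa [dilateKer_apply, hav, hs] using hv

end

/-- A Reeb vector of a covector `a` and an alternating `2`-form `η`. -/
structure IsReebVector (a : V →L[ℝ] ℝ) (η : V [⋀^Fin 2]→L[ℝ] ℝ) (r : V) : Prop where
  covector_eq_one : a r = 1
  toBilin_eq_zero : toBilin η r = 0

theorem eq_zero_of_wedgeAlt_ne_zero {a : E3 [⋀^Fin 1]→L[ℝ] ℝ} {η : E3 [⋀^Fin 2]→L[ℝ] ℝ}
    (h : wedgeAlt a η ≠ 0) {v : E3} (hav : toCovector a v = 0) (hηv : toBilin η v = 0) :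
    v = 0 := by
  have hι : interiorAlt v (wedgeAlt a η) = 0 := by
    rw [interiorAlt_wedgeAlt, hav, interiorAlt_eq_zero_iff.2 hηv, wedgeAlt_zero, zero_smul,
      sub_zero]
  exact eq_zero_of_curryLeft_eq_zero (n := 2) finrank_euclideanSpace_fin
    (ContinuousAlternatingMap.toAlternatingMap_injective.ne h)
    (congrArg ContinuousAlternatingMap.toAlternatingMap hι)

theorem exists_isReebVector {a : E3 [⋀^Fin 1]→L[ℝ] ℝ} {η : E3 [⋀^Fin 2]→L[ℝ] ℝ}
    (h : wedgeAlt a η ≠ 0) : ∃ r, IsReebVector (toCovector a) η r := by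
  have halt : (toBilin η).toBilinForm.IsAlt := fun v ↦ toBilin_self η v
  obtain ⟨v, hv0, hv⟩ := exists_ne_zero_of_isAlt_of_odd_finrank
    (by rw [finrank_euclideanSpace_fin]; decide) halt
  have hηv : toBilin η v = 0 := ContinuousLinearMap.ext fun w ↦ LinearMap.congr_fun hv w
  have hav : toCovector a v ≠ 0 := fun hav ↦ hv0 (eq_zero_of_wedgeAlt_ne_zero h hav hηv)
  exact ⟨(toCovector a v)⁻¹ • v, by simp [hav], by rw [map_smul, hηv, smul_zero]⟩

theorem IsReebVector.interiorAlt_wedgeAlt {a : E3 [⋀^Fin 1]→L[ℝ] ℝ} {η : E3 [⋀^Fin 2]→L[ℝ] ℝ}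
    {r : E3} (hr : IsReebVector (toCovector a) η r) : interiorAlt r (wedgeAlt a η) = η := by
  rw [ContactMaxwell.interiorAlt_wedgeAlt, hr.covector_eq_one, one_smul,
    interiorAlt_eq_zero_iff.2 hr.toBilin_eq_zero, wedgeAlt_zero, sub_zero]

/-- An inner product for which Reeb vectors are unit vectors orthogonal to the kernel of `a`. -/
structure IsReebMetric (a : V →L[ℝ] ℝ) (η : V [⋀^Fin 2]→L[ℝ] ℝ) (b : V →L[ℝ] V →L[ℝ] ℝ) : Prop
    extends IsInnerProduct b where
  apply_reeb : ∀ r, IsReebVector a η r → b r = a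

theorem convex_setOf_isReebMetric (a : V →L[ℝ] ℝ) (η : V [⋀^Fin 2]→L[ℝ] ℝ) :
    Convex ℝ {b | IsReebMetric a η b} := by
  refine fun b hb c hc s t hs ht hst ↦
    ⟨convex_setOf_isInnerProduct hb.toIsInnerProduct hc.toIsInnerProduct hs ht hst, fun r hr ↦ ?_⟩
  simp only [add_apply, smul_apply, hb.apply_reeb r hr, hc.apply_reeb r hr, ← add_smul, hst,
    one_smul]

theorem IsReebMetric.bilinearComp {a : W →L[ℝ] ℝ} {η : W [⋀^Fin 2]→L[ℝ] ℝ}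
    {b : W →L[ℝ] W →L[ℝ] ℝ} (hb : IsReebMetric a η b) {L : V →L[ℝ] W} (hL : L.IsInvertible) :
    IsReebMetric (a ∘L L) (η.compContinuousLinearMap L) (b.bilinearComp L L) := by
  obtain ⟨L, rfl⟩ := hL
  refine ⟨hb.toIsInnerProduct.bilinearComp L.injective, fun r hr ↦ ?_⟩
  have hLr : IsReebVector a η (L r) := by
    refine ⟨hr.covector_eq_one, ContinuousLinearMap.ext fun w ↦ ?_⟩
    have := congrArg (fun f ↦ f (L.symm w)) hr.toBilin_eq_zero
    simpa [toBilin_compContinuousLinearMap] using this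
  ext w
  simp [hb.apply_reeb _ hLr]

theorem IsReebMetric.scaleKer {a : V →L[ℝ] ℝ} {η : V [⋀^Fin 2]→L[ℝ] ℝ}
    {b : V →L[ℝ] V →L[ℝ] ℝ} (hb : IsReebMetric a η b) {r : V} (hr : IsReebVector a η r) {c : ℝ}
    (hc : 0 < c) : IsReebMetric a η (scaleKer a c b) where
  toIsInnerProduct := by
    rw [scaleKer_eq_bilinearComp hr.covector_eq_one hb.toIsInnerProduct (hb.apply_reeb r hr) hc.le]
    exact hb.toIsInnerProduct.bilinearComp
      (injective_dilateKer hr.covector_eq_one (Real.sqrt_pos.2 hc).ne')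
  apply_reeb q hq := by
    simp [ContactMaxwell.scaleKer, hb.apply_reeb q hq, hq.covector_eq_one]

theorem volRatio_scaleKer {ι : Type*} [Fintype ι] [DecidableEq ι] {a : V →L[ℝ] ℝ} {n : ℕ}
    (hV : Module.finrank ℝ V = n + 1) (e : Module.Basis ι ℝ V) (θ : V [⋀^ι]→L[ℝ] ℝ) {r : V}
    (har : a r = 1) {b : V →L[ℝ] V →L[ℝ] ℝ} (hb : IsInnerProduct b) (hr : b r = a) {c : ℝ}
    (hc : 0 < c) : volRatio e θ (scaleKer a c b) = volRatio e θ b / √c ^ n := by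
  have hs := Real.sqrt_pos.2 hc
  have := Module.finite_of_finrank_eq_succ hV
  have hdet : LinearMap.det (dilateKer a r √c : V →ₗ[ℝ] V) = √c ^ n := by
    have h := mul_det_dilateKer har hs.ne'
    rw [hV, pow_succ'] at h
    exact mul_left_cancel₀ hs.ne' h
  rw [scaleKer_eq_bilinearComp har hb hr hc.le, volRatio_bilinearComp, hdet,
    abs_of_pos (pow_pos hs n)]

/-- The inner product `a ⊗ a + ∑ i, ι(e i) η ⊗ ι(e i) η`. -/
def stdReebMetric {ι : Type*} [Fintype ι] (e : Module.Basis ι ℝ V) (a : V →L[ℝ] ℝ)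
    (η : V [⋀^Fin 2]→L[ℝ] ℝ) : V →L[ℝ] V →L[ℝ] ℝ :=
  a.smulRight a + ∑ i, (toBilin η (e i)).smulRight (toBilin η (e i))

theorem isReebMetric_stdReebMetric {ι : Type*} [Fintype ι] (e : Module.Basis ι ℝ V)
    {a : V →L[ℝ] ℝ} {η : V [⋀^Fin 2]→L[ℝ] ℝ} (h : ∀ v, a v = 0 → toBilin η v = 0 → v = 0) :
    IsReebMetric a η (stdReebMetric e a η) := by
  have happly (v w : V) : stdReebMetric e a η v w =
      a v * a w + ∑ i, toBilin η (e i) v * toBilin η (e i) w := by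
    simp [stdReebMetric]
  refine ⟨⟨fun v w ↦ by simp only [happly, mul_comm], fun v hv ↦ ?_⟩, fun r hr ↦ ?_⟩
  · have hsum : 0 ≤ ∑ i, toBilin η (e i) v * toBilin η (e i) v :=
      Finset.sum_nonneg fun i _ ↦ mul_self_nonneg _
    refine (happly v v ▸ add_nonneg (mul_self_nonneg _) hsum).lt_of_ne' fun h0 ↦ hv (h v ?_ ?_)
    · rw [happly] at h0
      exact mul_self_eq_zero.1 (by linarith [mul_self_nonneg (a v)])
    · have hzero : ∑ i, toBilin η (e i) v * toBilin η (e i) v = 0 := by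
        rw [happly] at h0
        linarith [mul_self_nonneg (a v)]
      rw [Finset.sum_eq_zero_iff_of_nonneg fun i _ ↦ mul_self_nonneg _] at hzero
      refine ContinuousLinearMap.coe_injective (e.ext fun i ↦ ?_)
      have := mul_self_eq_zero.1 (hzero i (Finset.mem_univ i))
      simp [toBilin_swap η v, this]
  · ext w
    simp [happly, hr.covector_eq_one, toBilin_swap η _ r, hr.toBilin_eq_zero]

end ReebMetrics

section ChartCalculus

variable {M : Type*} [TopologicalSpace M] [ChartedSpace E3 M] {k : ℕ}

theorem minSmoothness_two_le_infty : minSmoothness ℝ 2 ≤ ∞ := by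
  rw [minSmoothness_of_isRCLikeNormedField]
  exact WithTop.coe_le_coe.2 le_top

/-- A form at a point, seen as a form on the model space; the tangent spaces are copies of `E3`
without a norm. -/
def formAt (η : Form M k) (p : M) : E3 [⋀^Fin k]→L[ℝ] ℝ := η p

/-- The derivative of the chart around `x₀`, as an endomorphism of the model space. -/
def chartDeriv (x₀ : M) (p : M) : E3 →L[ℝ] E3 :=
  mfderiv (𝓡 3) 𝓘(ℝ, E3) (extChartAt (𝓡 3) x₀) p

/-- The derivative of the inverse of the chart around `x₀`, as an endomorphism of the model
space. -/
def chartSymmDeriv (x₀ : M) (y : E3) : E3 →L[ℝ] E3 :=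
  mfderiv 𝓘(ℝ, E3) (𝓡 3) (extChartAt (𝓡 3) x₀).symm y

theorem formAt_extDer (η : Form M k) (x : M) :
    formAt (extDer η) x =
      (extDeriv (chartRep η x) (extChartAt (𝓡 3) x x)).compContinuousLinearMap (chartDeriv x x) :=
  rfl

theorem chartRep_eq (η : Form M k) (x₀ : M) (y : E3) :
    chartRep η x₀ y = (formAt η ((extChartAt (𝓡 3) x₀).symm y)).compContinuousLinearMap
      (chartSymmDeriv x₀ y) :=
  rfl

theorem chartRep_wedge (a : Form M 1) (η : Form M k) (x₀ : M) (y : E3) :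
    chartRep (wedge a η) x₀ y = wedgeAlt (chartRep a x₀ y) (chartRep η x₀ y) := by
  rw [chartRep_eq a, chartRep_eq η, wedgeAlt_compContinuousLinearMap]
  rfl

theorem IsSmoothForm.contDiffAt {η : Form M k} (hη : IsSmoothForm η) {x₀ : M} {y : E3}
    (hy : y ∈ (extChartAt (𝓡 3) x₀).target) : ContDiffAt ℝ ∞ (chartRep η x₀) y :=
  (hη x₀).contDiffAt ((isOpen_extChartAt_target x₀).mem_nhds hy)

theorem isSmoothForm_smul (c : ℝ) {η : Form M k} (hη : IsSmoothForm η) :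
    IsSmoothForm fun x ↦ c • η x :=
  fun x₀ ↦ (hη x₀).const_smul c

theorem isSmoothFamily_smul {c : ℝ → ℝ} (hc : ContDiff ℝ ∞ c) {η : Form M k}
    (hη : IsSmoothForm η) : IsSmoothFamily fun t x ↦ c t • η x := fun x₀ ↦
  have hη' : ContDiffOn ℝ ∞ (fun p : ℝ × E3 ↦ chartRep η x₀ p.2)
      (Set.univ ×ˢ (extChartAt (𝓡 3) x₀).target) :=
    (hη x₀).comp contDiff_snd.contDiffOn fun _ hp ↦ hp.2
  (hc.comp contDiff_fst).contDiffOn.smul hη'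

theorem contDiffOn_toCovector {F : Type*} [NormedAddCommGroup F] [NormedSpace ℝ F] {s : Set F}
    {a : F → E3 [⋀^Fin 1]→L[ℝ] ℝ} (ha : ContDiffOn ℝ ∞ a s) :
    ContDiffOn ℝ ∞ (fun y ↦ toCovector (a y)) s :=
  (ContinuousAlternatingMap.ofSubsingletonLIE (𝕜 := ℝ) (E := E3) (F := ℝ)
    (0 : Fin 1)).symm.contDiff.comp_contDiffOn ha

theorem isSmoothForm_wedge {a : Form M 1} {η : Form M k} (ha : IsSmoothForm a)
    (hη : IsSmoothForm η) : IsSmoothForm (wedge a η) := fun x₀ ↦ by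
  refine ContDiffOn.congr ?_ fun y _ ↦ chartRep_wedge a η x₀ y
  exact (ContinuousAlternatingMap.alternatizeUncurryFinCLM ℝ E3 ℝ).contDiff.comp_contDiffOn
    ((contDiffOn_toCovector (ha x₀)).smulRight (hη x₀))

theorem extDer_smul (c : ℝ) (η : Form M k) (x : M) :
    extDer (fun x ↦ c • η x) x = c • extDer η x := by
  suffices formAt (extDer fun x ↦ c • η x) x = c • formAt (extDer η) x from this
  have h : chartRep (fun x ↦ c • η x) x = c • chartRep η x := rfl
  rw [formAt_extDer, formAt_extDer, h, extDeriv_smul]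
  rfl

variable [IsManifold (𝓡 3) ∞ M]

theorem mdifferentiableAt_extChartAt_symm {x₀ : M} {y : E3}
    (hy : y ∈ (extChartAt (𝓡 3) x₀).target) :
    MDifferentiableAt 𝓘(ℝ, E3) (𝓡 3) (extChartAt (𝓡 3) x₀).symm y := by
  have h := mdifferentiableWithinAt_extChartAt_symm (I := 𝓡 3) hy
  rwa [ModelWithCorners.range_eq_univ, mdifferentiableWithinAt_univ] at h

section

variable {x₀ : M} {y : E3} (hy : y ∈ (extChartAt (𝓡 3) x₀).target)

include hy

theorem chartDeriv_comp_chartSymmDeriv :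
    chartDeriv x₀ ((extChartAt (𝓡 3) x₀).symm y) ∘L chartSymmDeriv x₀ y =
      ContinuousLinearMap.id ℝ E3 := by
  have h := mfderiv_extChartAt_comp_mfderivWithin_extChartAt_symm (I := 𝓡 3) hy
  rwa [ModelWithCorners.range_eq_univ, mfderivWithin_univ] at h

theorem chartSymmDeriv_comp_chartDeriv :
    chartSymmDeriv x₀ y ∘L chartDeriv x₀ ((extChartAt (𝓡 3) x₀).symm y) =
      ContinuousLinearMap.id ℝ E3 := by
  have h := mfderivWithin_extChartAt_symm_comp_mfderiv_extChartAt (I := 𝓡 3) hy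
  rwa [ModelWithCorners.range_eq_univ, mfderivWithin_univ] at h

theorem isInvertible_chartSymmDeriv : (chartSymmDeriv x₀ y).IsInvertible :=
  .of_inverse (chartSymmDeriv_comp_chartDeriv hy) (chartDeriv_comp_chartSymmDeriv hy)

theorem chartRep_comp_chartDeriv (η : Form M k) :
    (chartRep η x₀ y).compContinuousLinearMap (chartDeriv x₀ ((extChartAt (𝓡 3) x₀).symm y)) =
      formAt η ((extChartAt (𝓡 3) x₀).symm y) := by
  ext v
  exact congrArg (fun L : E3 →L[ℝ] E3 ↦ formAt η _ (L ∘ v)) (chartSymmDeriv_comp_chartDeriv hy)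

theorem chartRep_ne_zero {η : Form M k} (hη : ∀ x, η x ≠ 0) : chartRep η x₀ y ≠ 0 := by
  intro h
  have hη0 := chartRep_comp_chartDeriv hy η
  rw [h] at hη0
  exact hη _ hη0.symm

end

/-- The transition map from the chart around `x₀` to the chart around `x₁`. -/
def transition (x₀ x₁ : M) (y : E3) : E3 :=
  extChartAt (𝓡 3) x₁ ((extChartAt (𝓡 3) x₀).symm y)

section

variable {x₀ x₁ : M} {y : E3} (hy : y ∈ (extChartAt (𝓡 3) x₀).target)
  (hy' : (extChartAt (𝓡 3) x₀).symm y ∈ (extChartAt (𝓡 3) x₁).source)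

include hy hy'

theorem contDiffAt_transition : ContDiffAt ℝ ∞ (transition x₀ x₁) y := by
  have hsymm : ContMDiffAt 𝓘(ℝ, E3) (𝓡 3) ∞ (extChartAt (𝓡 3) x₀).symm y :=
    (contMDiffOn_extChartAt_symm x₀).contMDiffAt ((isOpen_extChartAt_target x₀).mem_nhds hy)
  have hchart : ContMDiffAt (𝓡 3) 𝓘(ℝ, E3) ∞ (extChartAt (𝓡 3) x₁)
      ((extChartAt (𝓡 3) x₀).symm y) :=
    contMDiffAt_extChartAt' (by rwa [extChartAt_source] at hy')
  exact contMDiffAt_iff_contDiffAt.1 (hchart.comp y hsymm)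

theorem fderiv_transition :
    fderiv ℝ (transition x₀ x₁) y =
      chartDeriv x₁ ((extChartAt (𝓡 3) x₀).symm y) ∘L chartSymmDeriv x₀ y := by
  rw [extChartAt_source] at hy'
  have h := mfderiv_comp y (mdifferentiableAt_extChartAt hy') (mdifferentiableAt_extChartAt_symm hy)
  rwa [mfderiv_eq_fderiv] at h

theorem chartRep_eq_pullback_transition (η : Form M k) :
    chartRep η x₀ y = (chartRep η x₁ (transition x₀ x₁ y)).compContinuousLinearMap
      (fderiv ℝ (transition x₀ x₁) y) := by
  have h := chartRep_comp_chartDeriv ((extChartAt (𝓡 3) x₁).map_source hy') η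
  rw [(extChartAt (𝓡 3) x₁).left_inv hy'] at h
  rw [fderiv_transition hy hy', chartRep_eq, ← h]
  rfl

end

theorem chartRep_extDer {η : Form M k} (hη : IsSmoothForm η) {x₀ : M} {y : E3}
    (hy : y ∈ (extChartAt (𝓡 3) x₀).target) :
    chartRep (extDer η) x₀ y = extDeriv (chartRep η x₀) y := by
  set p := (extChartAt (𝓡 3) x₀).symm y with hp
  have hps : p ∈ (extChartAt (𝓡 3) p).source := mem_extChartAt_source p
  have hpullback : chartRep η x₀ =ᶠ[nhds y] fun z ↦
      (chartRep η p (transition x₀ p z)).compContinuousLinearMap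
        (fderiv ℝ (transition x₀ p) z) := by
    filter_upwards [(isOpen_extChartAt_target x₀).mem_nhds hy,
      (continuousAt_extChartAt_symm'' hy) (extChartAt_source_mem_nhds (I := 𝓡 3) p)]
      with z hz hz' using chartRep_eq_pullback_transition hz hz' η
  have hd : DifferentiableAt ℝ (chartRep η p) (transition x₀ p y) :=
    (hη.contDiffAt ((extChartAt (𝓡 3) p).map_source hps)).differentiableAt (by simp)
  rw [hpullback.extDeriv_eq,
    extDeriv_pullback hd (contDiffAt_transition hy hps) minSmoothness_two_le_infty,
    fderiv_transition hy hps, chartRep_eq, ← hp, formAt_extDer]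
  rfl

theorem isSmoothForm_extDer {η : Form M k} (hη : IsSmoothForm η) :
    IsSmoothForm (extDer η) := fun x₀ ↦ by
  refine ContDiffOn.congr ?_ fun y hy ↦ chartRep_extDer hη hy
  exact (ContinuousAlternatingMap.alternatizeUncurryFinCLM ℝ E3 ℝ).contDiff.comp_contDiffOn
    ((hη x₀).fderiv_of_isOpen (m := ∞) (isOpen_extChartAt_target x₀) (by simp))

theorem extDer_extDer {η : Form M k} (hη : IsSmoothForm η) (x : M) :
    extDer (extDer η) x = 0 := by
  have hx := mem_extChartAt_target (I := 𝓡 3) x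
  have h : chartRep (extDer η) x =ᶠ[nhds (extChartAt (𝓡 3) x x)] extDeriv (chartRep η x) := by
    filter_upwards [(isOpen_extChartAt_target x).mem_nhds hx] with y hy
      using chartRep_extDer hη hy
  suffices formAt (extDer (extDer η)) x = 0 from this
  rw [formAt_extDer, h.extDeriv_eq,
    extDeriv_extDeriv_apply (hη.contDiffAt hx) minSmoothness_two_le_infty]
  rfl

end ChartCalculus

section BilinearFields

variable {M : Type*} [TopologicalSpace M] [ChartedSpace E3 M]

variable (M) in
/-- Fields of bilinear forms on the tangent spaces of `M`. Smoothness is the separate predicate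
`IsSmoothBilin`. -/
abbrev BilinField : Type _ :=
  ∀ x : M, TangentSpace (𝓡 3) x →L[ℝ] TangentSpace (𝓡 3) x →L[ℝ] ℝ

/-- A bilinear field at a point, seen as a bilinear form on the model space. -/
def bilinAt (b : BilinField M) (p : M) : E3 →L[ℝ] E3 →L[ℝ] ℝ := b p

/-- The expression of a bilinear field in the chart around `x₀`, meaningful on the target of the
chart. -/
def bilinRep (b : BilinField M) (x₀ : M) (y : E3) : E3 →L[ℝ] E3 →L[ℝ] ℝ :=
  (bilinAt b ((extChartAt (𝓡 3) x₀).symm y)).bilinearComp (chartSymmDeriv x₀ y)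
    (chartSymmDeriv x₀ y)

/-- A bilinear field is smooth if it is smooth in the charts. -/
def IsSmoothBilin (b : BilinField M) : Prop :=
  ∀ x₀ : M, ContDiffOn ℝ ∞ (bilinRep b x₀) (extChartAt (𝓡 3) x₀).target

/-- The bilinear field around `x₀` with a given expression in the chart around `x₀`. -/
def bilinOfChart (x₀ : M) (B : E3 → E3 →L[ℝ] E3 →L[ℝ] ℝ) : BilinField M := fun x ↦
  ((B (extChartAt (𝓡 3) x₀ x)).bilinearComp (chartDeriv x₀ x) (chartDeriv x₀ x) :
    E3 →L[ℝ] E3 →L[ℝ] ℝ)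

theorem isSmoothBilin_smul (c : ℝ) {b : BilinField M} (hb : IsSmoothBilin b) :
    IsSmoothBilin fun x ↦ c • b x := fun x₀ ↦
  contDiffOn_clm_apply.2 fun _ ↦ contDiffOn_clm_apply.2 fun _ ↦
    contDiffOn_const.mul (((hb x₀).clm_apply contDiffOn_const).clm_apply contDiffOn_const)

variable [IsManifold (𝓡 3) ∞ M]

theorem bilinRep_bilinOfChart (B : E3 → E3 →L[ℝ] E3 →L[ℝ] ℝ) {x₀ : M} {y : E3}
    (hy : y ∈ (extChartAt (𝓡 3) x₀).target) : bilinRep (bilinOfChart x₀ B) x₀ y = B y := by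
  have hB : bilinAt (bilinOfChart x₀ B) ((extChartAt (𝓡 3) x₀).symm y) =
      (B y).bilinearComp (chartDeriv x₀ ((extChartAt (𝓡 3) x₀).symm y))
        (chartDeriv x₀ ((extChartAt (𝓡 3) x₀).symm y)) := by
    rw [bilinAt, bilinOfChart, (extChartAt (𝓡 3) x₀).right_inv hy]
  ext v w
  have hcomp (u : E3) := DFunLike.congr_fun (chartDeriv_comp_chartSymmDeriv hy) u
  simp only [ContinuousLinearMap.comp_apply, ContinuousLinearMap.id_apply] at hcomp
  rw [bilinRep, hB, ContinuousLinearMap.bilinearComp_apply,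
    ContinuousLinearMap.bilinearComp_apply, hcomp, hcomp]

theorem symmL_trivializationAt_eq_chartSymmDeriv {x₀ x : M} (hx : x ∈ (chartAt E3 x₀).source) :
    ((trivializationAt E3 (TangentSpace (𝓡 3)) x₀).symmL ℝ x : E3 →L[ℝ] E3) =
      chartSymmDeriv x₀ (extChartAt (𝓡 3) x₀ x) := by
  have h := TangentBundle.symmL_trivializationAt (𝕜 := ℝ) (I := 𝓡 3) hx
  rwa [ModelWithCorners.range_eq_univ, mfderivWithin_univ] at h

theorem trivializationAt_bilin_eq_bilinRep (b : BilinField M) {x₀ x : M}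
    (hx : x ∈ (chartAt E3 x₀).source) :
    (trivializationAt (E3 →L[ℝ] E3 →L[ℝ] ℝ)
      (fun x : M ↦ TangentSpace (𝓡 3) x →L[ℝ] TangentSpace (𝓡 3) x →L[ℝ] ℝ) x₀
        (Bundle.TotalSpace.mk' (E3 →L[ℝ] E3 →L[ℝ] ℝ) x (b x))).2 =
      bilinRep b x₀ (extChartAt (𝓡 3) x₀ x) := by
  have hx' : x ∈ (trivializationAt E3 (TangentSpace (𝓡 3)) x₀).baseSet := hx
  have hs : x ∈ (extChartAt (𝓡 3) x₀).source := by rwa [extChartAt_source]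
  rw [bilinRep, ← symmL_trivializationAt_eq_chartSymmDeriv hx, (extChartAt (𝓡 3) x₀).left_inv hs]
  ext v w
  rw [hom_trivializationAt_apply, inCoordinates_apply_eq₂ hx' hx' (Set.mem_univ x)]
  rw [Bundle.Trivialization.linearMapAt_apply]
  refine (if_pos (Set.mem_univ x)).trans ?_
  exact congrArg₂ (fun v w : E3 ↦ bilinAt b x v w)
    (Bundle.Trivialization.symmL_apply _ hx' v).symm
    (Bundle.Trivialization.symmL_apply _ hx' w).symm

set_option synthInstance.maxHeartbeats 100000 in
-- Instance search for the bundle of bilinear forms unfolds the tangent spaces to the model space.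
theorem contMDiffOn_bilin_iff {b : BilinField M} {x₀ : M} :
    ContMDiffOn (𝓡 3) ((𝓡 3).prod 𝓘(ℝ, E3 →L[ℝ] E3 →L[ℝ] ℝ)) ∞
      (fun x ↦ Bundle.TotalSpace.mk' (E3 →L[ℝ] E3 →L[ℝ] ℝ)
        (E := fun x : M ↦ TangentSpace (𝓡 3) x →L[ℝ] TangentSpace (𝓡 3) x →L[ℝ] ℝ) x (b x))
      (chartAt E3 x₀).source ↔
    ContDiffOn ℝ ∞ (bilinRep b x₀) (extChartAt (𝓡 3) x₀).target := by
  rw [(trivializationAt (E3 →L[ℝ] E3 →L[ℝ] ℝ)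
      (fun x : M ↦ TangentSpace (𝓡 3) x →L[ℝ] TangentSpace (𝓡 3) x →L[ℝ] ℝ)
      x₀).contMDiffOn_section_iff (chartAt E3 x₀).open_source (by simp),
    contMDiffOn_congr fun x hx ↦ trivializationAt_bilin_eq_bilinRep b hx,
    ← contMDiffOn_iff_contDiffOn, ← extChartAt_source (𝓡 3)]
  refine ⟨fun h ↦ ?_, fun h ↦ ?_⟩
  · refine (h.comp (contMDiffOn_extChartAt_symm x₀) (extChartAt (𝓡 3) x₀).mapsTo_symm).congr
      fun y hy ↦ ?_
    rw [Function.comp_apply, (extChartAt (𝓡 3) x₀).right_inv hy]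
  · refine h.comp ?_ (extChartAt (𝓡 3) x₀).mapsTo
    rw [extChartAt_source]
    exact contMDiffOn_extChartAt

theorem contMDiff_bilin_iff_isSmoothBilin {b : BilinField M} :
    ContMDiff (𝓡 3) ((𝓡 3).prod 𝓘(ℝ, E3 →L[ℝ] E3 →L[ℝ] ℝ)) ∞
      (fun x ↦ Bundle.TotalSpace.mk' (E3 →L[ℝ] E3 →L[ℝ] ℝ)
        (E := fun x : M ↦ TangentSpace (𝓡 3) x →L[ℝ] TangentSpace (𝓡 3) x →L[ℝ] ℝ) x (b x)) ↔
    IsSmoothBilin b := by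
  refine ⟨fun h x₀ ↦ contMDiffOn_bilin_iff.1 h.contMDiffOn, fun h x ↦ ?_⟩
  exact (contMDiffOn_bilin_iff.2 (h x)).contMDiffAt
    ((chartAt E3 x).open_source.mem_nhds (mem_chart_source E3 x))

end BilinearFields

section SmoothFamilies

variable {F V : Type*} [NormedAddCommGroup F] [NormedSpace ℝ F] [NormedAddCommGroup V]
  [NormedSpace ℝ V] {s : Set F} {a : F → V →L[ℝ] ℝ} {b : F → V →L[ℝ] V →L[ℝ] ℝ}

theorem contDiffOn_toBilin [FiniteDimensional ℝ V] {η : F → V [⋀^Fin 2]→L[ℝ] ℝ}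
    (hη : ContDiffOn ℝ ∞ η s) : ContDiffOn ℝ ∞ (fun y ↦ toBilin (η y)) s :=
  contDiffOn_clm_apply.2 fun v ↦ contDiffOn_clm_apply.2 fun w ↦ by
    simp only [toBilin_apply]
    exact (ContinuousAlternatingMap.apply ℝ V ℝ ![v, w]).contDiff.comp_contDiffOn hη

theorem contDiffOn_scaleKer {c : F → ℝ} (ha : ContDiffOn ℝ ∞ a s) (hc : ContDiffOn ℝ ∞ c s)
    (hb : ContDiffOn ℝ ∞ b s) : ContDiffOn ℝ ∞ (fun y ↦ scaleKer (a y) (c y) (b y)) s :=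
  (ha.smulRight ha).add (hc.smul (hb.sub (ha.smulRight ha)))

variable {ι : Type*} [Fintype ι] (e : Module.Basis ι ℝ V)

theorem contDiffOn_stdReebMetric [FiniteDimensional ℝ V] {η : F → V [⋀^Fin 2]→L[ℝ] ℝ}
    (ha : ContDiffOn ℝ ∞ a s) (hη : ContDiffOn ℝ ∞ η s) :
    ContDiffOn ℝ ∞ (fun y ↦ stdReebMetric e (a y) (η y)) s :=
  have hη' i := (contDiffOn_toBilin hη).clm_apply (contDiffOn_const (c := e i))
  (ha.smulRight ha).add (ContDiffOn.sum fun i _ ↦ (hη' i).smulRight (hη' i))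

variable [DecidableEq ι]

theorem contDiffOn_det_gramMatrix (hb : ContDiffOn ℝ ∞ b s) :
    ContDiffOn ℝ ∞ (fun y ↦ (gramMatrix e (b y)).det) s := by
  simp only [Matrix.det_apply, LinearMap.BilinForm.toMatrix_apply]
  exact ContDiffOn.sum fun σ _ ↦ ContDiffOn.const_smul _ <| contDiffOn_prod fun i _ ↦
    (hb.clm_apply contDiffOn_const).clm_apply contDiffOn_const

theorem contDiffOn_volRatio {θ : F → V [⋀^ι]→L[ℝ] ℝ} (hθ : ContDiffOn ℝ ∞ θ s)
    (hb : ContDiffOn ℝ ∞ b s) (hθ0 : ∀ y ∈ s, θ y ≠ 0) (hb0 : ∀ y ∈ s, IsInnerProduct (b y)) :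
    ContDiffOn ℝ ∞ (fun y ↦ volRatio e (θ y) (b y)) s := by
  have hdet := fun y hy ↦ (hb0 y hy).det_gramMatrix_pos e
  refine ContDiffOn.div (fun y hy ↦ ?_)
    ((contDiffOn_det_gramMatrix e hb).sqrt fun y hy ↦ (hdet y hy).ne')
    fun y hy ↦ (Real.sqrt_pos.2 (hdet y hy)).ne'
  have hθe := (ContinuousAlternatingMap.apply ℝ V ℝ e).contDiff.comp_contDiffOn hθ
  exact (contDiffAt_abs (apply_basis_ne_zero e (hθ0 y hy))).comp_contDiffWithinAt y (hθe y hy)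

end SmoothFamilies

section ReebFields

variable {M : Type*} [TopologicalSpace M] [ChartedSpace E3 M] {α : Form M 1} {b : BilinField M}

/-- A field of Reeb metrics of the `1`-form `α`. -/
def IsReebField (α : Form M 1) (b : BilinField M) : Prop :=
  ∀ x, IsReebMetric (toCovector (formAt α x)) (formAt (extDer α) x) (bilinAt b x)

/-- The basis of the model space to which `coordVec` refers. -/
def stdBasis : Module.Basis (Fin 3) ℝ E3 := (EuclideanSpace.basisFun (Fin 3) ℝ).toBasis

/-- The Reeb metrics around `x₀` with the expression `stdReebMetric` in the chart around `x₀`. -/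
def stdReebField (α : Form M 1) (x₀ : M) : BilinField M :=
  bilinOfChart x₀ fun y ↦
    stdReebMetric stdBasis (toCovector (chartRep α x₀ y)) (chartRep (extDer α) x₀ y)

/-- The rescaling of `b` on the kernel of `α` for which `θ` is, up to sign, `m` times the volume
form. -/
def rescaleField (α : Form M 1) (θ : Form M 3) (m : ℝ) (b : BilinField M) : BilinField M :=
  fun x ↦ scaleKer (toCovector (formAt α x))
    (volRatio stdBasis (formAt θ x) (bilinAt b x) / m) (bilinAt b x)

variable [IsManifold (𝓡 3) ∞ M]

theorem IsSmoothForm.contDiffOn_bilinRep_stdReebField (hα : IsSmoothForm α) (x₀ : M) :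
    ContDiffOn ℝ ∞ (bilinRep (stdReebField α x₀) x₀) (extChartAt (𝓡 3) x₀).target :=
  (contDiffOn_stdReebMetric stdBasis (contDiffOn_toCovector (hα x₀))
    (isSmoothForm_extDer hα x₀)).congr fun _ hy ↦ bilinRep_bilinOfChart _ hy

theorem IsContactForm.isReebMetric_stdReebField (hα : IsContactForm α) {x₀ x : M}
    (hx : x ∈ (extChartAt (𝓡 3) x₀).source) :
    IsReebMetric (toCovector (formAt α x)) (formAt (extDer α) x)
      (bilinAt (stdReebField α x₀) x) := by
  have hy := (extChartAt (𝓡 3) x₀).map_source hx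
  have hwedge := chartRep_ne_zero hy hα.wedge_ne_zero
  rw [chartRep_wedge] at hwedge
  have hinv : (chartDeriv x₀ x).IsInvertible := isInvertible_mfderiv_extChartAt hx
  have h := (isReebMetric_stdReebMetric stdBasis
    fun v ↦ eq_zero_of_wedgeAlt_ne_zero hwedge).bilinearComp hinv
  have hrep {k : ℕ} (η : Form M k) := chartRep_comp_chartDeriv hy η
  simp only [(extChartAt (𝓡 3) x₀).left_inv hx] at hrep
  rwa [← toCovector_compContinuousLinearMap, hrep, hrep] at h

set_option synthInstance.maxHeartbeats 100000 in
-- Instance search for the bundle of bilinear forms unfolds the tangent spaces to the model space.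
theorem IsContactForm.exists_isReebField [T2Space M] [SecondCountableTopology M]
    (hα : IsContactForm α) : ∃ b, IsSmoothBilin b ∧ IsReebField α b := by
  have : LocallyCompactSpace M := Manifold.locallyCompact_of_finiteDimensional (𝓡 3)
  obtain ⟨s, hs⟩ := exists_contMDiffSection_forall_mem_convex_of_local (n := ⊤) (𝓡 3)
    (F_fiber := E3 →L[ℝ] E3 →L[ℝ] ℝ)
    (fun x : M ↦ TangentSpace (𝓡 3) x →L[ℝ] TangentSpace (𝓡 3) x →L[ℝ] ℝ)
    (fun x ↦ {b | IsReebMetric (toCovector (formAt α x)) (formAt (extDer α) x) b})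
    (fun x b hb c hc _ _ hs ht hst ↦ by
      have h := convex_setOf_isReebMetric _ _ hb hc hs ht hst
      exact Set.mem_ofPred.2 h)
    (fun x₀ ↦ ⟨(chartAt E3 x₀).source,
      (chartAt E3 x₀).open_source.mem_nhds (mem_chart_source E3 x₀), stdReebField α x₀,
      contMDiffOn_bilin_iff.2 (hα.smooth.contDiffOn_bilinRep_stdReebField x₀),
      fun x hx ↦ hα.isReebMetric_stdReebField (by rwa [extChartAt_source])⟩)
  exact ⟨fun x ↦ s x, contMDiff_bilin_iff_isSmoothBilin.1 s.contMDiff, hs⟩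

theorem volRatio_chartRep_bilinRep (θ : Form M 3) (b : BilinField M) {x₀ : M} {y : E3}
    (hy : y ∈ (extChartAt (𝓡 3) x₀).target) :
    volRatio stdBasis (chartRep θ x₀ y) (bilinRep b x₀ y) =
      volRatio stdBasis (formAt θ ((extChartAt (𝓡 3) x₀).symm y))
        (bilinAt b ((extChartAt (𝓡 3) x₀).symm y)) := by
  obtain ⟨L, hL⟩ := isInvertible_chartSymmDeriv hy
  have hdet : LinearMap.det (chartSymmDeriv x₀ y : E3 →ₗ[ℝ] E3) ≠ 0 :=
    hL ▸ L.toLinearEquiv.isUnit_det'.ne_zero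
  rw [chartRep_eq, bilinRep, volRatio_bilinearComp, volRatio_compContinuousLinearMap]
  exact mul_div_cancel_left₀ _ (abs_ne_zero.2 hdet)

theorem bilinRep_rescaleField (α : Form M 1) (θ : Form M 3) (m : ℝ) (b : BilinField M) {x₀ : M}
    {y : E3} (hy : y ∈ (extChartAt (𝓡 3) x₀).target) :
    bilinRep (rescaleField α θ m b) x₀ y = scaleKer (toCovector (chartRep α x₀ y))
      (volRatio stdBasis (chartRep θ x₀ y) (bilinRep b x₀ y) / m) (bilinRep b x₀ y) := by
  rw [volRatio_chartRep_bilinRep θ b hy, chartRep_eq, toCovector_compContinuousLinearMap]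
  rfl

theorem isSmoothBilin_rescaleField (hα : IsSmoothForm α) {θ : Form M 3} (hθ : IsSmoothForm θ)
    (hθ0 : ∀ x, θ x ≠ 0) (m : ℝ) (hb : IsSmoothBilin b)
    (hb0 : ∀ x, IsInnerProduct (bilinAt b x)) : IsSmoothBilin (rescaleField α θ m b) := fun x₀ ↦
  have hinner y (hy : y ∈ (extChartAt (𝓡 3) x₀).target) : IsInnerProduct (bilinRep b x₀ y) :=
    (hb0 _).bilinearComp (isInvertible_chartSymmDeriv hy).injective
  have hvol := contDiffOn_volRatio stdBasis (hθ x₀) (hb x₀) (fun _ hy ↦ chartRep_ne_zero hy hθ0)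
    hinner
  (contDiffOn_scaleKer (contDiffOn_toCovector (hα x₀)) (hvol.div_const m) (hb x₀)).congr
    fun _ hy ↦ bilinRep_rescaleField α θ m b hy

theorem IsContactForm.exists_isReebField_volRatio_eq [T2Space M] [SecondCountableTopology M]
    (hα : IsContactForm α) {θ : Form M 3} (hθ : IsSmoothForm θ) (hθ0 : ∀ x, θ x ≠ 0) {m : ℝ}
    (hm : 0 < m) :
    ∃ b, IsSmoothBilin b ∧ IsReebField α b ∧
      ∀ x, volRatio stdBasis (formAt θ x) (bilinAt b x) = m := by
  obtain ⟨b, hsmooth, hb⟩ := hα.exists_isReebField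
  have hinner x := (hb x).toIsInnerProduct
  have hpos x := volRatio_pos stdBasis (hθ0 x) (hinner x)
  refine ⟨rescaleField α θ m b,
    isSmoothBilin_rescaleField hα.smooth hθ hθ0 m hsmooth hinner, fun x ↦ ?_, fun x ↦ ?_⟩ <;>
    obtain ⟨r, hr⟩ := exists_isReebVector (hα.wedge_ne_zero x)
  · exact (hb x).scaleKer hr (div_pos (hpos x) hm)
  · have h := volRatio_scaleKer (n := 2) finrank_euclideanSpace_fin stdBasis (formAt θ x)
      hr.covector_eq_one (hinner x) ((hb x).apply_reeb r hr) (div_pos (hpos x) hm)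
    rw [Real.sq_sqrt (div_pos (hpos x) hm).le] at h
    exact h.trans (div_div_cancel₀ (hpos x).ne')

end ReebFields

section Hodge

variable {M : Type*} [TopologicalSpace M] [ChartedSpace E3 M] [IsManifold (𝓡 3) ∞ M]

/-- The Riemannian metric given by a smooth field of inner products. -/
def metricOf (b : BilinField M) (hb : ∀ x, IsInnerProduct (bilinAt b x))
    (hsmooth : IsSmoothBilin b) : RMetric M where
  inner := b
  symm x := (hb x).symm
  pos x := (hb x).pos
  isVonNBounded x := (hb x).isVonNBounded
  contMDiff := contMDiff_bilin_iff_isSmoothBilin.2 hsmooth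

theorem isInnerProduct_inner (g : RMetric M) (x : M) : IsInnerProduct (bilinAt g.inner x) where
  symm := g.symm x
  pos := g.pos x

theorem exists_inner_eq_smul (g₀ : RMetric M) {k : ℝ} (hk : 0 < k) :
    ∃ g : RMetric M, ∀ x, g.inner x = k • g₀.inner x :=
  ⟨metricOf (fun x ↦ k • g₀.inner x)
    (fun x ↦ ⟨fun v w ↦ congrArg (k * ·) (g₀.symm x v w), fun v hv ↦ mul_pos hk (g₀.pos x v hv)⟩)
    (isSmoothBilin_smul k (contMDiff_bilin_iff_isSmoothBilin.1 g₀.contMDiff)), fun _ ↦ rfl⟩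

theorem gram_eq_gramMatrix (g : RMetric M) (x : M) :
    gram g x = gramMatrix stdBasis (bilinAt g.inner x) := by
  ext i j
  simp only [gramMatrix, LinearMap.BilinForm.toMatrix_apply, stdBasis, OrthonormalBasis.coe_toBasis,
    EuclideanSpace.basisFun_apply]
  rfl

theorem exists_inner_eq (g : RMetric M) (a : Form M 1) (x : M) :
    ∃ v, bilinAt g.inner x v = toCovector (formAt a x) :=
  (isInnerProduct_inner g x).isInvertible.surjective _

theorem sharp_eq_of_inner {g : RMetric M} {a : Form M 1} {x : M} {v : E3}
    (h : bilinAt g.inner x v = toCovector (formAt a x)) : sharp g a x = v :=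
  (isInnerProduct_inner g x).isInvertible.inverse_apply_eq.2 h.symm

theorem volForm_eq_volRatio_inv_smul (g : RMetric M) (θ : Form M 3) (x : M) :
    volForm g θ x = (volRatio stdBasis (formAt θ x) (bilinAt g.inner x))⁻¹ • formAt θ x := by
  have hcoord : coordVec x = stdBasis := by
    ext i : 1
    simp only [stdBasis, OrthonormalBasis.coe_toBasis, EuclideanSpace.basisFun_apply]
    rfl
  rw [volForm, volRatio, inv_div, gram_eq_gramMatrix, hcoord]
  rfl

theorem hodge_eq_of_inner {g : RMetric M} {a : Form M 1} {x : M} {v : E3}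
    (h : bilinAt g.inner x v = toCovector (formAt a x)) (θ : Form M 3) :
    formAt (hodge g θ a) x = (volRatio stdBasis (formAt θ x) (bilinAt g.inner x))⁻¹ •
      interiorAlt v (formAt θ x) := by
  rw [formAt, hodge, sharp_eq_of_inner h, volForm_eq_volRatio_inv_smul]
  rfl

theorem hodge_smul (g : RMetric M) (θ : Form M 3) (c : ℝ) (a : Form M 1) (x : M) :
    hodge g θ (fun x ↦ c • a x) x = c • hodge g θ a x := by
  obtain ⟨v, hv⟩ := exists_inner_eq g a x
  have hcv : bilinAt g.inner x (c • v) = toCovector (formAt (fun x ↦ c • a x) x) := by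
    rw [map_smul, hv]
    rfl
  have hform : formAt (hodge g θ fun x ↦ c • a x) x = c • formAt (hodge g θ a) x := by
    rw [hodge_eq_of_inner hcv, hodge_eq_of_inner hv, interiorAlt_smul, smul_comm]
  exact hform

theorem hodge_of_inner_eq_smul {g₀ g : RMetric M} {k : ℝ} (hk : 0 < k) {x : M}
    (h : g.inner x = k • g₀.inner x) (θ : Form M 3) (a : Form M 1) :
    hodge g θ a x = √k • hodge g₀ θ a x := by
  have hb : bilinAt g.inner x = k • bilinAt g₀.inner x := h
  obtain ⟨v, hv⟩ := exists_inner_eq g₀ a x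
  have hkv : bilinAt g.inner x (k⁻¹ • v) = toCovector (formAt a x) := by
    rw [hb, map_smul, smul_apply, hv, inv_smul_smul₀ hk.ne']
  have hscale : √k ^ 3 * k⁻¹ = √k := by
    rw [pow_succ', Real.sq_sqrt hk.le, mul_assoc, mul_inv_cancel₀ hk.ne', mul_one]
  have hform : formAt (hodge g θ a) x = √k • formAt (hodge g₀ θ a) x := by
    rw [hodge_eq_of_inner hkv, hodge_eq_of_inner hv, interiorAlt_smul, hb,
      volRatio_smul _ _ hk.le, Fintype.card_fin, inv_div, smul_smul, smul_smul]
    congr 1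
    linear_combination (volRatio stdBasis (formAt θ x) (bilinAt g₀.inner x))⁻¹ * hscale
  exact hform

end Hodge

section AdaptedMetrics

variable {M : Type*} [TopologicalSpace M] [ChartedSpace E3 M] [IsManifold (𝓡 3) ∞ M]
  {α : Form M 1}

theorem IsContactForm.isAdapted (hα : IsContactForm α) {g : RMetric M}
    (hg : IsReebField α g.inner)
    (hvol : ∀ x, volRatio stdBasis (formAt (wedge α (extDer α)) x) (bilinAt g.inner x) = 2) :
    IsAdapted g α where
  extDer_eq x := by
    obtain ⟨r, hr⟩ := exists_isReebVector (hα.wedge_ne_zero x)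
    have hι : interiorAlt r (formAt (wedge α (extDer α)) x) = formAt (extDer α) x :=
      hr.interiorAlt_wedgeAlt
    have hform : formAt (extDer α) x =
        (2 : ℝ) • formAt (hodge g (wedge α (extDer α)) α) x := by
      rw [hodge_eq_of_inner ((hg x).apply_reeb r hr), hvol, hι, smul_inv_smul₀ two_ne_zero]
    exact hform
  norm_sharp x := by
    obtain ⟨r, hr⟩ := exists_isReebVector (hα.wedge_ne_zero x)
    rw [sharp_eq_of_inner ((hg x).apply_reeb r hr)]
    exact (DFunLike.congr_fun ((hg x).apply_reeb r hr) r).trans hr.covector_eq_one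

theorem IsContactForm.exists_isAdapted [T2Space M] [SecondCountableTopology M]
    (hα : IsContactForm α) : ∃ g : RMetric M, IsAdapted g α := by
  obtain ⟨b, hsmooth, hb, hvol⟩ := hα.exists_isReebField_volRatio_eq
    (isSmoothForm_wedge hα.smooth (isSmoothForm_extDer hα.smooth)) hα.wedge_ne_zero two_pos
  exact ⟨metricOf b (fun x ↦ (hb x).toIsInnerProduct) hsmooth, hα.isAdapted hb hvol⟩

end AdaptedMetrics

section Maxwell

theorem re_mul_exp (a om t : ℝ) :
    ((a : ℂ) * Complex.exp (Complex.I * om * t)).re = Real.cos (om * t) * a := by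
  rw [show Complex.I * om * t = ((om * t : ℝ) : ℂ) * Complex.I by push_cast; ring,
    Complex.re_ofReal_mul, Complex.exp_ofReal_mul_I_re, mul_comm]

theorem im_mul_exp (a om t : ℝ) :
    ((a : ℂ) * Complex.exp (Complex.I * om * t)).im = Real.sin (om * t) * a := by
  rw [show Complex.I * om * t = ((om * t : ℝ) : ℂ) * Complex.I by push_cast; ring,
    Complex.im_ofReal_mul, Complex.exp_ofReal_mul_I_im, mul_comm]

theorem hasDerivAt_cos_mul (om t : ℝ) :
    HasDerivAt (fun s ↦ Real.cos (om * s)) (-(om * Real.sin (om * t))) t :=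
  (((hasDerivAt_id' t).const_mul om).cos).congr_deriv (by ring)

theorem hasDerivAt_sin_mul (om t : ℝ) :
    HasDerivAt (fun s ↦ Real.sin (om * s)) (om * Real.cos (om * t)) t :=
  (((hasDerivAt_id' t).const_mul om).sin).congr_deriv (by ring)

variable {M : Type*} [TopologicalSpace M] [ChartedSpace E3 M] [IsManifold (𝓡 3) ∞ M]
  {α : Form M 1}

theorem isSourceFreeMaxwell_of_smul (hα : IsSmoothForm α) {e h d b : ℝ → ℝ}
    (he : ContDiff ℝ ∞ e) (hh : ContDiff ℝ ∞ h) (hd : ContDiff ℝ ∞ d) (hb : ContDiff ℝ ∞ b)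
    (hbe : ∀ t, HasDerivAt b (-e t) t) (hdh : ∀ t, HasDerivAt d (h t) t) :
    IsSourceFreeMaxwell (fun t x ↦ e t • α x) (fun t x ↦ h t • α x)
      (fun t x ↦ d t • extDer α x) (fun t x ↦ b t • extDer α x) where
  smooth_E := isSmoothFamily_smul he hα
  smooth_H := isSmoothFamily_smul hh hα
  smooth_D := isSmoothFamily_smul hd (isSmoothForm_extDer hα)
  smooth_B := isSmoothFamily_smul hb (isSmoothForm_extDer hα)
  faraday t x v := by
    rw [extDer_smul]
    exact ((hbe t).mul_const (extDer α x v)).congr_deriv (neg_mul _ _)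
  ampere t x v := by
    rw [extDer_smul]
    exact (hdh t).mul_const (extDer α x v)
  gauss_D t x := by rw [extDer_smul, extDer_extDer hα, smul_zero]
  gauss_B t x := by rw [extDer_smul, extDer_extDer hα, smul_zero]

theorem IsAdapted.hodge_eq_smul_extDer {g₀ g : RMetric M} (hg₀ : IsAdapted g₀ α) {k : ℝ}
    (hk : 0 < k) {x : M} (h : g.inner x = k • g₀.inner x) :
    hodge g (wedge α (extDer α)) α x = (√k / 2) • extDer α x := by
  rw [hodge_of_inner_eq_smul hk h, hg₀.extDer_eq x, smul_smul, div_mul_cancel₀ _ two_ne_zero]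

theorem exists_isSourceFreeMaxwell_of_hodge_eq_smul_extDer (hα : IsSmoothForm α) {g : RMetric M}
    {θ : Form M 3} {om c : ℝ} (hc : (om * c) ^ 2 = 1)
    (hstar : ∀ x, hodge g θ α x = c • extDer α x) :
    ∃ β : Form M 1, IsSmoothForm β ∧ ∃ (E H : ℝ → Form M 1) (D B : ℝ → Form M 2),
      (∀ t x v, E t x v = ((α x v : ℂ) * Complex.exp (Complex.I * om * t)).re) ∧
      (∀ t x v, H t x v = ((β x v : ℂ) * Complex.exp (Complex.I * om * t)).im) ∧
      IsSourceFreeMaxwell E H D B ∧ IsConstitutive g g θ E H D B := by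
  refine ⟨fun x ↦ (-(om * c)) • α x, isSmoothForm_smul _ hα,
    fun t x ↦ Real.cos (om * t) • α x, fun t x ↦ (Real.sin (om * t) * -(om * c)) • α x,
    fun t x ↦ (Real.cos (om * t) * c) • extDer α x,
    fun t x ↦ (Real.sin (om * t) * -(om * c) * c) • extDer α x,
    fun t x v ↦ (re_mul_exp (α x v) om t).symm,
    fun t x v ↦ (mul_assoc _ _ (α x v)).trans (im_mul_exp (-(om * c) * α x v) om t).symm,
    isSourceFreeMaxwell_of_smul hα (by fun_prop) (by fun_prop) (by fun_prop) (by fun_prop)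
      (fun t ↦ ?faraday) (fun t ↦ ?ampere),
    fun t x ↦ ?electric, fun t x ↦ ?magnetic⟩
  case faraday =>
    refine (((hasDerivAt_sin_mul om t).mul_const _).mul_const c).congr_deriv ?_
    linear_combination -Real.cos (om * t) * hc
  case ampere => exact ((hasDerivAt_cos_mul om t).mul_const c).congr_deriv (by ring)
  case electric => rw [hodge_smul, hstar, smul_smul]
  case magnetic => rw [hodge_smul, hstar, smul_smul]

end Maxwell

end ContactMaxwell

end

theorem theorem1 {M : Type*} [TopologicalSpace M] [T2Space M] [SecondCountableTopology M]
    [ChartedSpace ContactMaxwell.E3 M] [IsManifold (𝓡 3) ∞ M]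
    (α : ContactMaxwell.Form M 1) (hα : ContactMaxwell.IsContactForm α)
    (om : ℝ) (hom : om ≠ 0) :
    ∃ g₀ : ContactMaxwell.RMetric M, ContactMaxwell.IsAdapted g₀ α ∧
    ∃ g : ContactMaxwell.RMetric M,
      (∀ (x : M) (v w : TangentSpace (𝓡 3) x),
        g.inner x v w = 4 / om ^ 2 * g₀.inner x v w) ∧
    ∃ β : ContactMaxwell.Form M 1, ContactMaxwell.IsSmoothForm β ∧
    ∃ (E H : ℝ → ContactMaxwell.Form M 1) (D B : ℝ → ContactMaxwell.Form M 2),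
      (∀ t x v, E t x v = ((α x v : ℂ) * Complex.exp (Complex.I * om * t)).re) ∧
      (∀ t x v, H t x v = ((β x v : ℂ) * Complex.exp (Complex.I * om * t)).im) ∧
      ContactMaxwell.IsSourceFreeMaxwell E H D B ∧
      ContactMaxwell.IsConstitutive g g
        (ContactMaxwell.wedge α (ContactMaxwell.extDer α)) E H D B := by
  have hk : 0 < 4 / om ^ 2 := by positivity
  have hc : (om * (√(4 / om ^ 2) / 2)) ^ 2 = 1 := by
    rw [mul_pow, div_pow, Real.sq_sqrt hk.le]
    field_simp
    norm_num
  obtain ⟨g₀, hg₀⟩ := hα.exists_isAdapted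
  obtain ⟨g, hg⟩ := ContactMaxwell.exists_inner_eq_smul g₀ hk
  exact ⟨g₀, hg₀, g, fun x v w ↦ congrArg (fun b ↦ b v w) (hg x),
    ContactMaxwell.exists_isSourceFreeMaxwell_of_hodge_eq_smul_extDer hα.smooth hc
      fun x ↦ hg₀.hodge_eq_smul_extDer hk (hg x)⟩
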